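/- Let $\mathcal{M}_2$ be the algebra of complex $2\times 2$ matrices, with matrix units $E_{jk}$, and let $\mathcal{S}$ be the convex set of stochastic maps on $\mathcal{M}_2$, i.e. of all completely positive, trace-preserving linear maps $\mathcal{M}_2\to\mathcal{M}_2$. A generalized extreme point of $\mathcal{S}$ is an element of the closure of the set of extreme points of $\mathcal{S}$, the closure being taken in the finite-dimensional space of linear maps $\mathcal{M}_2\to\mathcal{M}_2$. For a linear map $\Phi:\mathcal{M}_2\to\mathcal{M}_2$ let $\widehat{\Phi}$ be its adjoint for the Hilbert--Schmidt inner product $\langle A,B\rangle=\operatorname{Tr}A^\dagger B$, so that $\operatorname{Tr}\,\Phi(A)^\dagger B=\operatorname{Tr}\,A^\dagger\widehat{\Phi}(B)$ for all $A,B\in\mathcal{M}_2$, and let $$\beta(\widehat{\Phi})=\begin{pmatrix}\widehat{\Phi}(E_{11})&\widehat{\Phi}(E_{12})\\ \widehat{\Phi}(E_{21})&\widehat{\Phi}(E_{22})\end{pmatrix},$$ a $4\times 4$ matrix written in $2\times 2$ blocks. Theorem. A linear map $\Phi:\mathcal{M}_2\to\mathcal{M}_2$ is a generalized extreme point of $\mathcal{S}$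 if and only if there are matrices $A,U\in\mathcal{M}_2$ with $0\le A\le I$ (in the positive semidefinite order) and $U$ unitary such that $$\beta(\widehat{\Phi})=\begin{pmatrix}A&\sqrt{A}\,U\sqrt{I-A}\\ \sqrt{I-A}\,U^\dagger\sqrt{A}&I-A\end{pmatrix}.$$ -/

import Mathlib

open scoped Matrix MatrixOrder Matrix.Norms.L2Operator CStarAlgebra

noncomputable section

/-- The algebra of complex `2 × 2` matrices. The scoped instances opened above give it its operator
norm, hence its structure of a C⋆-algebra, and its Loewner order (`A ≤ B` iff `B - A` is positive
semidefinite). -/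
abbrev M2 : Type := Matrix (Fin 2) (Fin 2) ℂ

/-- Complete positivity, in the sense of Mathlib's bundled completely positive maps: applying `Φ`
entrywise to positive elements of `M_k(M2)` gives positive elements, for every `k`. -/
def IsCompletelyPositive (Φ : M2 →ₗ[ℂ] M2) : Prop :=
  ∃ Ψ : M2 →CP M2, Ψ.toLinearMap = Φ

/-- Trace preservation. -/
def IsTracePreserving (Φ : M2 →ₗ[ℂ] M2) : Prop :=
  ∀ ρ : M2, (Φ ρ).trace = ρ.trace

/-- The convex set of stochastic maps on `M2`, in the finite-dimensional normed space of all
(automatically continuous) linear maps `M2 → M2`. -/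
def stochasticMaps : Set (M2 →L[ℂ] M2) :=
  {Φ | IsCompletelyPositive (Φ : M2 →ₗ[ℂ] M2) ∧ IsTracePreserving (Φ : M2 →ₗ[ℂ] M2)}

/-- Generalized extreme points: the closure of the set of extreme points. -/
def generalizedExtremePoints : Set (M2 →L[ℂ] M2) :=
  closure (Set.extremePoints ℝ stochasticMaps)

/-- The adjoint of a linear map on `M2` with respect to the Hilbert-Schmidt inner product
`⟨A, B⟩ = Tr (A† B)`. The `(j, k)` entry of the image of `B` is the inner product of `Φ(E_jk)`
with `B`; see `hsAdjoint_spec` and `hsAdjoint_unique`. -/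
def hsAdjoint (Φ : M2 →ₗ[ℂ] M2) : M2 →ₗ[ℂ] M2 where
  toFun B := Matrix.of fun j k => ((Φ (Matrix.single j k 1))ᴴ * B).trace
  map_add' B C := by
    ext j k
    simp [Matrix.mul_add]
  map_smul' c B := by
    ext j k
    simp

theorem hsAdjoint_spec (Φ : M2 →ₗ[ℂ] M2) (A B : M2) :
    ((Φ A)ᴴ * B).trace = (Aᴴ * hsAdjoint Φ B).trace := by
  have hA : A = A 0 0 • Matrix.single 0 0 1 + A 0 1 • Matrix.single 0 1 1
      + A 1 0 • Matrix.single 1 0 1 + A 1 1 • Matrix.single 1 1 1 := by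
    ext j k
    fin_cases j <;> fin_cases k <;> simp
  conv_lhs => rw [hA]
  simp only [map_add, map_smul, Matrix.conjTranspose_add, Matrix.conjTranspose_smul,
    Matrix.add_mul, Matrix.smul_mul, Matrix.trace_add, Matrix.trace_smul, smul_eq_mul]
  rw [Matrix.trace_fin_two (Aᴴ * hsAdjoint Φ B)]
  simp only [Matrix.mul_apply, Fin.sum_univ_two, Matrix.conjTranspose_apply, hsAdjoint,
    LinearMap.coe_mk, AddHom.coe_mk, Matrix.of_apply]
  ring

theorem hsAdjoint_unique (Φ Ψ : M2 →ₗ[ℂ] M2)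
    (h : ∀ A B : M2, ((Φ A)ᴴ * B).trace = (Aᴴ * Ψ B).trace) : Ψ = hsAdjoint Φ := by
  ext1 B
  ext j k
  have := h (Matrix.single j k 1) B
  simp [Matrix.conjTranspose_single, Matrix.trace_single_mul] at this
  simp [hsAdjoint, this]

/-- The block matrix `β(Ω)` of the images of the matrix units under `Ω`. -/
def choiMatrix (Ω : M2 →ₗ[ℂ] M2) : Matrix (Fin 2 ⊕ Fin 2) (Fin 2 ⊕ Fin 2) ℂ :=
  Matrix.fromBlocks (Ω (Matrix.single 0 0 1)) (Ω (Matrix.single 0 1 1))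
    (Ω (Matrix.single 1 0 1)) (Ω (Matrix.single 1 1 1))

end

section

open scoped ComplexOrder

/-! `choiAdjoint` is a real-linear homeomorphism carrying the stochastic maps onto
`unitalChoiMatrices`, so it suffices to show that the closure of the extreme points there is
`unitaryBlocks`. Upper bound: if `A` and `1 - A` are positive definite, the Schur complement writes
the corner as `√A R √(1 - A)` with `R` a contraction, and `R` is the midpoint of two unitaries. By
compactness of `unitaryBlocks`, every member of the convex set is a midpoint of two unitary blocks,
so an extreme point is one of them. Lower bound: a unitary block with `A` positive definite and `tr
A ≠ 1` is extreme (`unitaryBlock_mem_extremePoints`), since the kernel of a positive matrix is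
inherited by its convex components. Such blocks are dense in `unitaryBlocks`. -/

/-! ### Compactness, polar decomposition and contractions. -/

theorem isCompact_unitaryGroup : IsCompact (Matrix.unitaryGroup (Fin 2) ℂ : Set M2) := by
  have : ProperSpace M2 := FiniteDimensional.proper ℂ M2
  refine Metric.isCompact_of_isClosed_isBounded ?_ ?_
  · have : (Matrix.unitaryGroup (Fin 2) ℂ : Set M2) = {U : M2 | star U * U = 1} := by
      ext U
      exact Matrix.mem_unitaryGroup_iff'
    rw [this]
    exact isClosed_eq (by fun_prop) continuous_const
  · refine (Metric.isBounded_closedBall (x := (0 : M2)) (r := 1)).subset fun U hU => ?_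
    simpa using (CStarRing.norm_of_mem_unitary hU).le

theorem isCompact_Icc_zero_one : IsCompact (Set.Icc (0 : M2) 1) := by
  have : ProperSpace M2 := FiniteDimensional.proper ℂ M2
  refine Metric.isCompact_of_isClosed_isBounded isClosed_Icc ?_
  refine (Metric.isBounded_closedBall (x := (0 : M2)) (r := 1)).subset fun A hA => ?_
  simpa using (CStarAlgebra.norm_le_one_iff_of_nonneg A hA.1).2 hA.2

theorem continuousOn_cfcSqrt : ContinuousOn (CFC.sqrt : M2 → M2) {A | 0 ≤ A} := by
  have := ContinuousOn.cfcₙ_nnreal_of_mem_nhdsSet (A := M2) (s := Set.univ) (t := {A : M2 | 0 ≤ A})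
    (a := id) NNReal.sqrt Filter.univ_mem continuousOn_id (fun _ h => h)
    NNReal.continuous_sqrt.continuousOn NNReal.sqrt_zero
  exact this

theorem frequently_isUnit_add_smul_one (R : M2) :
    ∃ᶠ z : ℂ in nhds 0, IsUnit (R + z • (1 : M2)) := by
  have hfin : (spectrum ℂ (-R)).Finite := Matrix.finite_spectrum _
  have : Dense (spectrum ℂ (-R))ᶜ := hfin.countable.dense_compl ℂ
  have h0 := mem_closure_iff_frequently.1 (this 0)
  refine h0.mono fun z hz => ?_
  have hz' := spectrum.notMem_iff.1 hz
  rw [Algebra.algebraMap_eq_smul_one, sub_neg_eq_add, add_comm] at hz'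
  exact hz'

/-- Polar decomposition of a square matrix. -/
theorem exists_unitary_mul_abs (R : M2) :
    ∃ U ∈ Matrix.unitaryGroup (Fin 2) ℂ, R = U * CFC.abs R := by
  let K : Set M2 := Matrix.unitaryGroup (Fin 2) ℂ
  have : CompactSpace K := isCompact_iff_compactSpace.1 isCompact_unitaryGroup
  let S : Set (K × M2) := {p | p.2 = p.1 * CFC.abs p.2}
  have hS : IsClosed S := by
    refine isClosed_eq continuous_snd ?_
    exact (continuous_subtype_val.comp continuous_fst).mul
      (CFC.continuous_abs.comp continuous_snd)
  -- Projection along the compact unitary group is closed, so the matrices with a polar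
  -- decomposition form a closed set; invertible ones belong to it and are dense.
  have hcl := isClosedMap_snd_of_compactSpace _ hS
  have key : ∀ T : M2, IsUnit T → T ∈ Prod.snd '' S := by
    intro T hT
    have hsq : CFC.abs T * CFC.abs T = star T * T := CFC.abs_mul_abs T
    have habs : IsUnit (CFC.abs T) := by
      have : IsUnit (CFC.abs T * CFC.abs T) := hsq ▸ hT.star.mul hT
      exact isUnit_of_mul_isUnit_left this
    obtain ⟨P, hP⟩ := habs
    have hsa : star (P : M2) = P := by
      rw [hP]; exact (CFC.abs_nonneg T).isSelfAdjoint
    have hsa' : star (↑P⁻¹ : M2) = ↑P⁻¹ := by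
      have : star P = P := Units.ext hsa
      rw [← Units.coe_star, star_inv, this]
    refine ⟨(⟨T * ↑P⁻¹, ?_⟩, T), ?_, rfl⟩
    · refine Matrix.mem_unitaryGroup_iff'.2 ?_
      rw [star_mul, hsa', mul_assoc, ← mul_assoc (star T), ← hsq, ← hP]
      simp
    · change T = T * ↑P⁻¹ * CFC.abs T
      rw [← hP]; simp
  have hmem : R ∈ Prod.snd '' S := by
    rw [← hcl.closure_eq]
    have htend : Filter.Tendsto (fun z : ℂ => R + z • (1 : M2)) (nhds 0) (nhds R) := by
      have : Continuous (fun z : ℂ => R + z • (1 : M2)) := by fun_prop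
      simpa using this.tendsto 0
    refine mem_closure_iff_frequently.2 ?_
    exact htend.frequently ((frequently_isUnit_add_smul_one R).mono fun z hz => key _ hz)
  obtain ⟨⟨⟨U, hU⟩, T⟩, h, rfl⟩ := hmem
  exact ⟨U, hU, h⟩

/-- A contraction is the midpoint of two unitaries. -/
theorem exists_unitary_midpoint (R : M2) (hR : star R * R ≤ 1) :
    ∃ U ∈ Matrix.unitaryGroup (Fin 2) ℂ, ∃ V ∈ Matrix.unitaryGroup (Fin 2) ℂ,
      R = (2⁻¹ : ℝ) • (U + V) := by
  obtain ⟨W, hW, hWR⟩ := exists_unitary_mul_abs R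
  have hn : ‖CFC.abs R‖ ≤ 1 := by
    rw [CFC.norm_abs]
    have h1 := (CStarAlgebra.norm_le_one_iff_of_nonneg (star R * R) (star_mul_self_nonneg R)).2 hR
    rw [CStarRing.norm_star_mul_self] at h1
    nlinarith [norm_nonneg R]
  let a : selfAdjoint M2 := ⟨CFC.abs R, (CFC.abs_nonneg R).isSelfAdjoint⟩
  -- `u = |R| + i√(1 - |R|²)` is unitary with real part `|R|`.
  let u := selfAdjoint.unitarySelfAddISMul a hn
  refine ⟨W * u, mul_mem hW u.2, W * star u, mul_mem hW (star u).2, ?_⟩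
  have h1 : ((star u : unitary M2) : M2) = a - Complex.I • CFC.sqrt (1 - a ^ 2 : M2) :=
    selfAdjoint.star_coe_unitarySelfAddISMul a hn
  have h2 : ((u : unitary M2) : M2) = a + Complex.I • CFC.sqrt (1 - a ^ 2 : M2) := rfl
  rw [← mul_add, h1, h2, add_add_sub_cancel, ← two_smul ℝ (a : M2), mul_smul_comm, smul_smul]
  norm_num
  exact hWR

/-! ### Extreme points are unitary blocks. -/

/-- Positive semidefinite block matrices whose diagonal blocks sum to the identity. -/
def unitalChoiMatrices : Set (Matrix (Fin 2 ⊕ Fin 2) (Fin 2 ⊕ Fin 2) ℂ) :=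
  {B | B.PosSemidef ∧ B.toBlocks₁₁ + B.toBlocks₂₂ = 1}

/-- The block matrix determined by an effect `A` and a unitary `U`. -/
noncomputable def unitaryBlock (A U : M2) : Matrix (Fin 2 ⊕ Fin 2) (Fin 2 ⊕ Fin 2) ℂ :=
  Matrix.fromBlocks A (CFC.sqrt A * U * CFC.sqrt (1 - A))
    (CFC.sqrt (1 - A) * Uᴴ * CFC.sqrt A) (1 - A)

/-- The set of all block matrices determined by an effect and a unitary. -/
def unitaryBlocks : Set (Matrix (Fin 2 ⊕ Fin 2) (Fin 2 ⊕ Fin 2) ℂ) :=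
  {B | ∃ A U : M2, 0 ≤ A ∧ A ≤ 1 ∧ U ∈ Matrix.unitaryGroup (Fin 2) ℂ ∧ B = unitaryBlock A U}

theorem conjTranspose_cfcSqrt (A : M2) : (CFC.sqrt A)ᴴ = CFC.sqrt A :=
  (CFC.sqrt_nonneg A).isSelfAdjoint

theorem unitaryBlock_mem_unitalChoiMatrices {A U : M2} (h0 : 0 ≤ A) (h1 : A ≤ 1)
    (hU : U ∈ Matrix.unitaryGroup (Fin 2) ℂ) : unitaryBlock A U ∈ unitalChoiMatrices := by
  have hU' : Uᴴ * U = 1 := Matrix.mem_unitaryGroup_iff'.1 hU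
  refine ⟨?_, by simp [unitaryBlock]⟩
  have : unitaryBlock A U = Matrix.fromRows (CFC.sqrt A) (CFC.sqrt (1 - A) * Uᴴ) *
      (Matrix.fromRows (CFC.sqrt A) (CFC.sqrt (1 - A) * Uᴴ))ᴴ := by
    rw [Matrix.conjTranspose_fromRows_eq_fromCols_conjTranspose, Matrix.fromRows_mul_fromCols,
      unitaryBlock, Matrix.conjTranspose_mul, Matrix.conjTranspose_conjTranspose,
      conjTranspose_cfcSqrt, conjTranspose_cfcSqrt, CFC.sqrt_mul_sqrt_self A h0]
    congr 1
    · rw [Matrix.mul_assoc]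
    · rw [Matrix.mul_assoc, ← Matrix.mul_assoc Uᴴ, hU', Matrix.one_mul,
        CFC.sqrt_mul_sqrt_self _ (sub_nonneg.2 h1)]
  rw [this]
  exact Matrix.posSemidef_self_mul_conjTranspose _

theorem continuousOn_unitaryBlock :
    ContinuousOn (fun p : M2 × M2 => unitaryBlock p.1 p.2) (Set.Icc 0 1 ×ˢ Set.univ) := by
  have hA : ContinuousOn (fun p : M2 × M2 => CFC.sqrt p.1) (Set.Icc 0 1 ×ˢ Set.univ) :=
    continuousOn_cfcSqrt.comp continuousOn_fst fun p hp => hp.1.1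
  have hA' : ContinuousOn (fun p : M2 × M2 => CFC.sqrt (1 - p.1)) (Set.Icc 0 1 ×ˢ Set.univ) :=
    continuousOn_cfcSqrt.comp (by fun_prop) fun p hp => sub_nonneg.2 hp.1.2
  have hb : Continuous fun q : M2 × M2 × M2 × M2 =>
      Matrix.fromBlocks q.1 q.2.1 q.2.2.1 q.2.2.2 := by fun_prop
  have hs : ContinuousOn (fun p : M2 × M2 => p.2ᴴ) (Set.Icc 0 1 ×ˢ Set.univ) := by fun_prop
  exact hb.comp_continuousOn (continuousOn_fst.prodMk (((hA.mul continuousOn_snd).mul hA').prodMk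
    (((hA'.mul hs).mul hA).prodMk (continuousOn_const.sub continuousOn_fst))))

theorem isCompact_unitaryBlocks : IsCompact unitaryBlocks := by
  have : unitaryBlocks = (fun p : M2 × M2 => unitaryBlock p.1 p.2) ''
      (Set.Icc 0 1 ×ˢ (Matrix.unitaryGroup (Fin 2) ℂ : Set M2)) := by
    ext B
    constructor
    · rintro ⟨A, U, h0, h1, hU, rfl⟩
      exact ⟨(A, U), ⟨⟨h0, h1⟩, hU⟩, rfl⟩
    · rintro ⟨⟨A, U⟩, ⟨⟨h0, h1⟩, hU⟩, rfl⟩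
      exact ⟨A, U, h0, h1, hU, rfl⟩
  rw [this]
  exact (isCompact_Icc_zero_one.prod isCompact_unitaryGroup).image_of_continuousOn
    (continuousOn_unitaryBlock.mono (Set.prod_mono_right (Set.subset_univ _)))

theorem exists_midpoint_of_isStrictlyPositive {A C : M2} (hA : IsStrictlyPositive A)
    (hA' : IsStrictlyPositive (1 - A)) (hB : (Matrix.fromBlocks A C Cᴴ (1 - A)).PosSemidef) :
    ∃ U ∈ Matrix.unitaryGroup (Fin 2) ℂ, ∃ V ∈ Matrix.unitaryGroup (Fin 2) ℂ,
      Matrix.fromBlocks A C Cᴴ (1 - A) = (2⁻¹ : ℝ) • (unitaryBlock A U + unitaryBlock A V) := by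
  set S := CFC.sqrt A with hS
  set T := CFC.sqrt (1 - A) with hT
  have hSS : S * S = A := CFC.sqrt_mul_sqrt_self A hA.nonneg
  have hTT : T * T = 1 - A := CFC.sqrt_mul_sqrt_self _ hA'.nonneg
  have hSu : IsUnit S := CFC.isUnit_sqrt_iff_isStrictlyPositive.2 hA
  have hTu : IsUnit T := CFC.isUnit_sqrt_iff_isStrictlyPositive.2 hA'
  have hSd := (Matrix.isUnit_iff_isUnit_det S).1 hSu
  have hTd := (Matrix.isUnit_iff_isUnit_det T).1 hTu
  have hSh : Sᴴ = S := conjTranspose_cfcSqrt A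
  have hTh : Tᴴ = T := conjTranspose_cfcSqrt (1 - A)
  have hTT1 : T⁻¹ * (1 - A) * T⁻¹ = 1 := by
    rw [← hTT, ← Matrix.mul_assoc, Matrix.nonsing_inv_mul _ hTd, Matrix.one_mul,
      Matrix.mul_nonsing_inv _ hTd]
  have hpd : A.PosDef := Matrix.isStrictlyPositive_iff_posDef.1 hA
  let _ : Invertible A := hA.isUnit.invertible
  have hschur := (Matrix.PosDef.fromBlocks₁₁ C (1 - A) hpd).1 hB
  -- Conjugating the Schur complement inequality `C† A⁻¹ C ≤ 1 - A` by `T⁻¹` makes `S⁻¹ C T⁻¹` a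
  -- contraction.
  have hR : star (S⁻¹ * C * T⁻¹) * (S⁻¹ * C * T⁻¹) ≤ 1 := by
    have h2 := hschur.conjTranspose_mul_mul_same T⁻¹
    rw [Matrix.conjTranspose_nonsing_inv, hTh, Matrix.mul_sub, Matrix.sub_mul, hTT1] at h2
    have h3 : star (S⁻¹ * C * T⁻¹) * (S⁻¹ * C * T⁻¹) = T⁻¹ * (Cᴴ * A⁻¹ * C) * T⁻¹ := by
      rw [Matrix.star_eq_conjTranspose]
      simp only [Matrix.conjTranspose_mul, Matrix.conjTranspose_nonsing_inv, hTh, hSh]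
      rw [← hSS, Matrix.mul_inv_rev]
      simp only [Matrix.mul_assoc]
    rw [h3]
    exact h2
  obtain ⟨U, hU, V, hV, h⟩ := exists_unitary_midpoint _ hR
  have hC : C = (2⁻¹ : ℝ) • (S * U * T + S * V * T) := by
    rw [← Matrix.add_mul, ← Matrix.mul_add, ← Matrix.smul_mul, ← Matrix.mul_smul, ← h,
      Matrix.mul_assoc, Matrix.mul_assoc, Matrix.nonsing_inv_mul _ hTd, Matrix.mul_one,
      ← Matrix.mul_assoc, Matrix.mul_nonsing_inv _ hSd, Matrix.one_mul]
  refine ⟨U, hU, V, hV, ?_⟩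
  have hhalf : ∀ X : M2, (2⁻¹ : ℝ) • (X + X) = X := fun X => by
    rw [← two_smul ℝ X, smul_smul]; norm_num
  have hCh : Cᴴ = (2⁻¹ : ℝ) • (T * Uᴴ * S + T * Vᴴ * S) := by
    rw [hC, Matrix.conjTranspose_smul]
    simp [hSh, hTh, Matrix.mul_assoc]
  rw [unitaryBlock, unitaryBlock, Matrix.fromBlocks_add, Matrix.fromBlocks_smul, hhalf, hhalf,
    ← hS, ← hT, ← hC, ← hCh]

theorem eq_fromBlocks_of_mem_unitalChoiMatrices {B : Matrix (Fin 2 ⊕ Fin 2) (Fin 2 ⊕ Fin 2) ℂ}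
    (hB : B ∈ unitalChoiMatrices) : ∃ A C : M2, 0 ≤ A ∧ 0 ≤ 1 - A ∧
      B = Matrix.fromBlocks A C Cᴴ (1 - A) := by
  refine ⟨B.toBlocks₁₁, B.toBlocks₁₂, ?_, ?_, ?_⟩
  · exact Matrix.nonneg_iff_posSemidef.2 (hB.1.submatrix Sum.inl)
  · rw [← hB.2, add_sub_cancel_left]
    exact Matrix.nonneg_iff_posSemidef.2 (hB.1.submatrix Sum.inr)
  · have h21 : B.toBlocks₂₁ = B.toBlocks₁₂ᴴ := by
      ext i j
      exact (hB.1.isHermitian.apply _ _).symm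
    conv_lhs => rw [← Matrix.fromBlocks_toBlocks B]
    rw [h21, ← hB.2, add_sub_cancel_left]

theorem isStrictlyPositive_smul_add_smul_one {A : M2} (hA : 0 ≤ A) {s t : ℝ} (hs : 0 ≤ s)
    (ht : 0 < t) : IsStrictlyPositive (s • A + t • (1 : M2)) := by
  refine IsStrictlyPositive.nonneg_add (smul_nonneg hs hA) ?_
  exact IsStrictlyPositive.smul ht isStrictlyPositive_one

theorem exists_midpoint_of_mem_unitalChoiMatrices
    {B : Matrix (Fin 2 ⊕ Fin 2) (Fin 2 ⊕ Fin 2) ℂ} (hB : B ∈ unitalChoiMatrices) :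
    ∃ G ∈ unitaryBlocks, ∃ G' ∈ unitaryBlocks, B = (2⁻¹ : ℝ) • (G + G') := by
  have hcl : IsClosed ((fun p : Matrix (Fin 2 ⊕ Fin 2) (Fin 2 ⊕ Fin 2) ℂ × _ =>
      (2⁻¹ : ℝ) • (p.1 + p.2)) '' (unitaryBlocks ×ˢ unitaryBlocks)) :=
    ((isCompact_unitaryBlocks.prod isCompact_unitaryBlocks).image (by fun_prop)).isClosed
  obtain ⟨A, C, h0, h1, rfl⟩ := eq_fromBlocks_of_mem_unitalChoiMatrices hB
  -- Half the identity lies in the convex set and has positive definite diagonal blocks; mixing it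
  -- in gives both blocks that property.
  let F : ℝ → Matrix (Fin 2 ⊕ Fin 2) (Fin 2 ⊕ Fin 2) ℂ := fun t =>
    (1 - t) • Matrix.fromBlocks A C Cᴴ (1 - A) + (t / 2) • 1
  have hF : Continuous F := by fun_prop
  have hF0 : Filter.Tendsto F (nhdsWithin 0 (Set.Ioo 0 1))
      (nhds (Matrix.fromBlocks A C Cᴴ (1 - A))) := by
    have := (hF.tendsto 0).mono_left (nhdsWithin_le_nhds (s := Set.Ioo 0 1))
    simpa [F] using this
  have : (nhdsWithin (0 : ℝ) (Set.Ioo 0 1)).NeBot := left_nhdsWithin_Ioo_neBot one_pos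
  have hmem := hcl.mem_of_tendsto hF0 (by
    filter_upwards [self_mem_nhdsWithin] with t ht
    have ht0 : 0 < t / 2 := by linarith [ht.1]
    have ht1 : 0 ≤ 1 - t := by linarith [ht.2]
    have e1 : 1 - ((1 - t) • A + (t / 2) • (1 : M2)) = (1 - t) • (1 - A) + (t / 2) • (1 : M2) := by
      module
    have e2 : F t = Matrix.fromBlocks ((1 - t) • A + (t / 2) • (1 : M2)) ((1 - t) • C)
        ((1 - t) • C)ᴴ (1 - ((1 - t) • A + (t / 2) • (1 : M2))) := by
      rw [e1]
      simp only [F]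
      rw [← Matrix.fromBlocks_one, Matrix.fromBlocks_smul, Matrix.fromBlocks_smul,
        Matrix.fromBlocks_add]
      simp [Matrix.conjTranspose_smul]
    have hpsd : (F t).PosSemidef := by
      refine Matrix.PosSemidef.add ?_ ?_
      · exact Matrix.nonneg_iff_posSemidef.1 (smul_nonneg ht1 (Matrix.nonneg_iff_posSemidef.2 hB.1))
      · exact Matrix.nonneg_iff_posSemidef.1
          (smul_nonneg ht0.le (Matrix.nonneg_iff_posSemidef.2 Matrix.PosSemidef.one))
    have hs := isStrictlyPositive_smul_add_smul_one h0 ht1 ht0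
    have hs' := isStrictlyPositive_smul_add_smul_one h1 ht1 ht0
    rw [← e1] at hs'
    rw [e2] at hpsd ⊢
    obtain ⟨U, hU, V, hV, h⟩ := exists_midpoint_of_isStrictlyPositive hs hs' hpsd
    exact ⟨(_, _), ⟨⟨_, U, hs.nonneg, sub_nonneg.1 hs'.nonneg, hU, rfl⟩,
      ⟨_, V, hs.nonneg, sub_nonneg.1 hs'.nonneg, hV, rfl⟩⟩, h.symm⟩)
  obtain ⟨⟨G, G'⟩, ⟨hG, hG'⟩, h⟩ := hmem
  exact ⟨G, hG, G', hG', h.symm⟩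

theorem unitaryBlocks_subset_unitalChoiMatrices : unitaryBlocks ⊆ unitalChoiMatrices := by
  rintro _ ⟨A, U, h0, h1, hU, rfl⟩
  exact unitaryBlock_mem_unitalChoiMatrices h0 h1 hU

theorem extremePoints_subset_unitaryBlocks :
    Set.extremePoints ℝ unitalChoiMatrices ⊆ unitaryBlocks := by
  intro B hB
  obtain ⟨G, hG, G', hG', rfl⟩ := exists_midpoint_of_mem_unitalChoiMatrices hB.1
  have := hB.2 (unitaryBlocks_subset_unitalChoiMatrices hG)
    (unitaryBlocks_subset_unitalChoiMatrices hG')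
    ⟨2⁻¹, 2⁻¹, by norm_num, by norm_num, by norm_num, by rw [smul_add]⟩
  rwa [← this]

/-! ### Generic unitary blocks are extreme, and dense. -/

/-- By Cayley–Hamilton `H² = (tr H) H`, so `H` is a real multiple of `H² ≥ 0`, or zero. -/
theorem nonneg_or_neg_nonneg_of_det_eq_zero {H : M2} (hH : Hᴴ = H) (hdet : H.det = 0) :
    0 ≤ H ∨ 0 ≤ -H := by
  have hsq : H * H = H.trace • H := by
    rw [Matrix.det_fin_two] at hdet
    ext i j
    fin_cases i <;> fin_cases j <;>
      simp [Matrix.mul_apply, Matrix.trace_fin_two, Fin.sum_univ_two] <;>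
      first | ring1 | linear_combination -hdet
  have hnn : 0 ≤ H * H := by
    have := star_mul_self_nonneg H
    rwa [Matrix.star_eq_conjTranspose, hH] at this
  have htr : H.trace = ((H.trace.re : ℝ) : ℂ) := by
    have : star H.trace = H.trace := by rw [← Matrix.trace_conjTranspose, hH]
    exact (Complex.conj_eq_iff_real.1 this).elim fun r hr => by rw [hr]; simp
  rw [htr, Complex.coe_smul] at hsq
  generalize H.trace.re = r at hsq
  rcases lt_trichotomy r 0 with hr | rfl | hr
  · right
    have : -H = (-r)⁻¹ • (H * H) := by
      rw [hsq, smul_smul, inv_neg, neg_mul, inv_mul_cancel₀ hr.ne, neg_one_smul]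
    rw [this]
    exact smul_nonneg (inv_nonneg.2 (neg_nonneg.2 hr.le)) hnn
  · left
    have h0 : Hᴴ * H = 0 := by rw [hH, hsq, zero_smul]
    rw [Matrix.conjTranspose_mul_self_eq_zero.1 h0]
  · left
    have : H = r⁻¹ • (H * H) := by rw [hsq, smul_smul, inv_mul_cancel₀ hr.ne', one_smul]
    rw [this]
    exact smul_nonneg (inv_nonneg.2 hr.le) hnn

/-- In even size `det (-H) = det H`, so determinants force `det H = 0` and `H` is semidefinite.
Conjugation by `Z` preserves its sign, whereas `-H` reverses it. -/
theorem eq_zero_of_conj_eq_neg {H Z : M2} (hH : Hᴴ = H) (hZ : star Z.det * Z.det ≠ 1)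
    (h : Zᴴ * H * Z = -H) : H = 0 := by
  have hdet : H.det = 0 := by
    have h1 := congrArg Matrix.det h
    rw [Matrix.det_mul, Matrix.det_mul, Matrix.det_conjTranspose, Matrix.det_neg] at h1
    have h2 : (star Z.det * Z.det - 1) * H.det = 0 := by
      simp only [Fintype.card_fin, even_two, Even.neg_pow, one_pow, one_mul] at h1
      linear_combination h1
    exact (mul_eq_zero.1 h2).resolve_left (sub_ne_zero.2 hZ)
  rcases nonneg_or_neg_nonneg_of_det_eq_zero hH hdet with h0 | h0
  · have := star_left_conjugate_nonneg h0 Z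
    rw [Matrix.star_eq_conjTranspose, h] at this
    exact le_antisymm (neg_nonneg.1 this) h0
  · have := star_left_conjugate_nonneg h0 Z
    rw [Matrix.star_eq_conjTranspose, Matrix.mul_neg, Matrix.neg_mul, h, neg_neg] at this
    exact le_antisymm (neg_nonneg.1 h0) this

/-- The two nonnegative quadratic forms at `v` have a vanishing positive combination, so each
vanishes. -/
theorem mulVec_eq_zero_of_mem_openSegment {n : Type*} [Fintype n] {B B₁ B₂ : Matrix n n ℂ}
    (h₁ : B₁.PosSemidef) (h₂ : B₂.PosSemidef) (hB : B ∈ openSegment ℝ B₁ B₂) {v : n → ℂ}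
    (hv : B *ᵥ v = 0) : B₁ *ᵥ v = 0 := by
  obtain ⟨a, b, ha, hb, -, rfl⟩ := hB
  have p₁ := h₁.dotProduct_mulVec_nonneg v
  have p₂ := h₂.dotProduct_mulVec_nonneg v
  have hs : (a : ℂ) * (star v ⬝ᵥ B₁ *ᵥ v) + (b : ℂ) * (star v ⬝ᵥ B₂ *ᵥ v) = 0 := by
    have := congrArg (star v ⬝ᵥ ·) hv
    simpa [Matrix.add_mulVec, Matrix.smul_mulVec, dotProduct_add, dotProduct_smul] using this
  have ha' : (0 : ℂ) < a := by exact_mod_cast ha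
  have hb' : (0 : ℂ) < b := by exact_mod_cast hb
  have := (add_eq_zero_iff_of_nonneg (mul_nonneg ha'.le p₁) (mul_nonneg hb'.le p₂)).1 hs
  exact (h₁.dotProduct_mulVec_zero_iff v).1 ((mul_eq_zero.1 this.1).resolve_left ha'.ne')

theorem fromBlocks_mul_fromRows_eq_zero_iff {A C Z : M2} :
    Matrix.fromBlocks A C Cᴴ (1 - A) * Matrix.fromRows (-Z) (1 : M2) = 0 ↔
      C = A * Z ∧ 1 - A = Cᴴ * Z := by
  rw [Matrix.fromBlocks_mul_fromRows, ← Matrix.fromRows_zero, Matrix.fromRows_ext_iff]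
  rw [Matrix.mul_neg, Matrix.mul_neg, Matrix.mul_one, Matrix.mul_one, neg_add_eq_zero,
    neg_add_eq_zero, eq_comm, eq_comm (a := Cᴴ * Z)]

/-- The columns of `(-Z; 1)`, with `Z = A^(-1/2) U (1 - A)^(1/2)`, lie in the kernel, hence in that
of any component. Thus `1 - A = Z† A Z` and `1 - A₁ = Z† A₁ Z`, so `H = A₁ - A` satisfies `Z† H Z =
-H`; here `|det Z|² = det (1 - A) / det A ≠ 1`. -/
theorem unitaryBlock_mem_extremePoints {A U : M2} (hA : IsStrictlyPositive A) (h1 : A ≤ 1)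
    (hU : U ∈ Matrix.unitaryGroup (Fin 2) ℂ) (hdet : A.det ≠ (1 - A).det) :
    unitaryBlock A U ∈ Set.extremePoints ℝ unitalChoiMatrices := by
  have hU' : Uᴴ * U = 1 := Matrix.mem_unitaryGroup_iff'.1 hU
  refine mem_extremePoints_iff_left.2
    ⟨unitaryBlock_mem_unitalChoiMatrices hA.nonneg h1 hU, fun B₁ hB₁ B₂ hB₂ hseg => ?_⟩
  obtain ⟨A₁, C₁, hA₁, -, rfl⟩ := eq_fromBlocks_of_mem_unitalChoiMatrices hB₁
  set S := CFC.sqrt A with hS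
  set T := CFC.sqrt (1 - A) with hT
  have hSS : S * S = A := CFC.sqrt_mul_sqrt_self A hA.nonneg
  have hTT : T * T = 1 - A := CFC.sqrt_mul_sqrt_self _ (sub_nonneg.2 h1)
  have hSh : Sᴴ = S := conjTranspose_cfcSqrt A
  have hTh : Tᴴ = T := conjTranspose_cfcSqrt (1 - A)
  have hSu : IsUnit S := CFC.isUnit_sqrt_iff_isStrictlyPositive.2 hA
  have hSd := (Matrix.isUnit_iff_isUnit_det S).1 hSu
  set Z := S⁻¹ * U * T with hZ
  have hC : S * U * T = A * Z := by
    rw [hZ, ← hSS]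
    simp only [Matrix.mul_assoc]
    rw [Matrix.mul_nonsing_inv_cancel_left _ _ hSd]
  have hCh : (S * U * T)ᴴ = T * Uᴴ * S := by
    simp [Matrix.conjTranspose_mul, hSh, hTh, Matrix.mul_assoc]
  have hD : 1 - A = (S * U * T)ᴴ * Z := by
    rw [hCh, hZ]
    simp only [Matrix.mul_assoc]
    rw [Matrix.mul_nonsing_inv_cancel_left _ _ hSd, ← Matrix.mul_assoc Uᴴ, hU', Matrix.one_mul, hTT]
  have hub : unitaryBlock A U = Matrix.fromBlocks A (S * U * T) (S * U * T)ᴴ (1 - A) := by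
    rw [hCh, unitaryBlock]
  rw [hub] at hseg ⊢
  have hker := fromBlocks_mul_fromRows_eq_zero_iff.2 ⟨hC, hD⟩
  have hker₁ : Matrix.fromBlocks A₁ C₁ C₁ᴴ (1 - A₁) * Matrix.fromRows (-Z) (1 : M2) = 0 := by
    refine Matrix.ext_of_mulVec_single fun i => ?_
    rw [← Matrix.mulVec_mulVec, Matrix.zero_mulVec]
    refine mulVec_eq_zero_of_mem_openSegment hB₁.1 hB₂.1 hseg ?_
    rw [Matrix.mulVec_mulVec, hker, Matrix.zero_mulVec]
  obtain ⟨hC₁, hD₁⟩ := fromBlocks_mul_fromRows_eq_zero_iff.1 hker₁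
  have hAh : Aᴴ = A := hA.nonneg.isSelfAdjoint
  have hAh₁ : A₁ᴴ = A₁ := hA₁.isSelfAdjoint
  rw [hC, Matrix.conjTranspose_mul, hAh] at hD
  rw [hC₁, Matrix.conjTranspose_mul, hAh₁] at hD₁
  have hZdet : star Z.det * Z.det ≠ 1 := by
    intro h
    apply hdet
    rw [hD, Matrix.det_mul, Matrix.det_mul, Matrix.det_conjTranspose]
    linear_combination -A.det * h
  have hH : A₁ - A = 0 := by
    refine eq_zero_of_conj_eq_neg (Z := Z) (by rw [Matrix.conjTranspose_sub, hAh, hAh₁]) hZdet ?_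
    rw [Matrix.mul_sub, Matrix.sub_mul, ← hD, ← hD₁]
    abel
  rw [hC, hC₁, sub_eq_zero.1 hH]

/-- Turns the condition `det A ≠ det (1 - A)` into `tr A ≠ 1`. -/
theorem det_one_sub (A : M2) : (1 - A).det = 1 - A.trace + A.det := by
  simp [Matrix.det_fin_two, Matrix.trace_fin_two]
  ring

/-- With `z = tr A`, the left side is the trace of `(1 - t) A + t c I`: the path must leave the
hyperplane of trace 1 if it starts there (`c = 1/3`), and otherwise reach it only at `t = 1` (`c =
1/2`). -/
theorem exists_forall_mul_add_ne_one (z : ℂ) :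
    ∃ c ∈ Set.Ioo (0 : ℝ) 1, ∀ t ∈ Set.Ioo (0 : ℝ) 1, (1 - t : ℂ) * z + 2 * (t * c) ≠ 1 := by
  by_cases hz : z = 1
  · refine ⟨3⁻¹, by norm_num, fun t ht h => ?_⟩
    rw [hz] at h
    push_cast at h
    have : (t : ℂ) = 0 := by linear_combination -3 * h
    exact ht.1.ne' (by exact_mod_cast this)
  · refine ⟨2⁻¹, by norm_num, fun t ht h => ?_⟩
    push_cast at h
    have h2 : (1 - t : ℂ) * (z - 1) = 0 := by linear_combination h
    rcases mul_eq_zero.1 h2 with h3 | h3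
    · have : (t : ℂ) = 1 := (sub_eq_zero.1 h3).symm
      exact ht.2.ne (by exact_mod_cast this)
    · exact hz (sub_eq_zero.1 h3)

theorem unitaryBlocks_subset_closure_extremePoints :
    unitaryBlocks ⊆ closure (Set.extremePoints ℝ unitalChoiMatrices) := by
  rintro _ ⟨A, U, h0, h1, hU, rfl⟩
  obtain ⟨c, hc, hne⟩ := exists_forall_mul_add_ne_one A.trace
  let F : ℝ → M2 := fun t => (1 - t) • A + (t * c) • 1
  have hF : Continuous F := by fun_prop
  have hF0 : F 0 = A := by simp [F]
  have hsp : ∀ t ∈ Set.Ioo (0 : ℝ) 1, IsStrictlyPositive (F t) := fun t ht =>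
    isStrictlyPositive_smul_add_smul_one h0 (sub_nonneg.2 ht.2.le) (mul_pos ht.1 hc.1)
  have hle : ∀ t ∈ Set.Ioo (0 : ℝ) 1, F t ≤ 1 := fun t ht => by
    have e : 1 - F t = (1 - t) • (1 - A) + (t * (1 - c)) • (1 : M2) := by
      simp only [F]; module
    rw [← sub_nonneg, e]
    exact (isStrictlyPositive_smul_add_smul_one (sub_nonneg.2 h1) (sub_nonneg.2 ht.2.le)
      (mul_pos ht.1 (sub_pos.2 hc.2))).nonneg
  have : (nhdsWithin (0 : ℝ) (Set.Ioo 0 1)).NeBot := left_nhdsWithin_Ioo_neBot one_pos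
  have htend : Filter.Tendsto (fun t => unitaryBlock (F t) U) (nhdsWithin 0 (Set.Ioo 0 1))
      (nhds (unitaryBlock A U)) := by
    have hcont := continuousOn_unitaryBlock (A, U) ⟨⟨h0, h1⟩, trivial⟩
    refine hcont.tendsto.comp (tendsto_nhdsWithin_iff.2 ⟨?_, ?_⟩ :
      Filter.Tendsto (fun t => (F t, U)) _ _)
    · have h2 : Continuous fun t => (F t, U) := by fun_prop
      have h3 := (h2.tendsto 0).mono_left (nhdsWithin_le_nhds (s := Set.Ioo 0 1))
      rwa [hF0] at h3
    · filter_upwards [self_mem_nhdsWithin] with t ht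
      exact ⟨⟨(hsp t ht).nonneg, hle t ht⟩, trivial⟩
  refine mem_closure_of_tendsto htend ?_
  filter_upwards [self_mem_nhdsWithin] with t ht
  refine unitaryBlock_mem_extremePoints (hsp t ht) (hle t ht) hU fun h => hne t ht ?_
  rw [det_one_sub] at h
  have htr : (F t).trace = (1 - t : ℂ) * A.trace + 2 * (t * c) := by
    simp [F, Matrix.trace_add, Matrix.trace_smul]
    ring
  rw [← htr]
  linear_combination h

theorem closure_extremePoints_unitalChoiMatrices :
    closure (Set.extremePoints ℝ unitalChoiMatrices) = unitaryBlocks :=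
  (closure_minimal extremePoints_subset_unitaryBlocks
    isCompact_unitaryBlocks.isClosed).antisymm unitaryBlocks_subset_closure_extremePoints

/-! ### Choi's theorem for the adjoint, and transfer to stochastic maps. -/

theorem nonneg_iff_exists_eq_star_mul_self {A : Type*} [NonUnitalCStarAlgebra A] [PartialOrder A]
    [StarOrderedRing A] {a : A} : 0 ≤ a ↔ ∃ b, a = star b * b :=
  CStarAlgebra.nonneg_iff_eq_star_mul_self

/-- The diagonal blocks sum to the adjoint's value at `1`, and trace preservation is dual to
unitality. -/
theorem isTracePreserving_iff (Φ : M2 →ₗ[ℂ] M2) :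
    IsTracePreserving Φ ↔
      (choiMatrix (hsAdjoint Φ)).toBlocks₁₁ + (choiMatrix (hsAdjoint Φ)).toBlocks₂₂ = 1 := by
  have h1 : (choiMatrix (hsAdjoint Φ)).toBlocks₁₁ + (choiMatrix (hsAdjoint Φ)).toBlocks₂₂ =
      hsAdjoint Φ 1 := by
    have : (1 : M2) = Matrix.single 0 0 1 + Matrix.single 1 1 1 := by
      ext i j; fin_cases i <;> fin_cases j <;> simp
    rw [this, map_add]
    simp [choiMatrix]
  rw [h1]
  constructor
  · intro h
    ext j k
    simp only [hsAdjoint, LinearMap.coe_mk, AddHom.coe_mk, Matrix.of_apply, Matrix.mul_one,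
      Matrix.trace_conjTranspose, h (Matrix.single j k 1)]
    fin_cases j <;> fin_cases k <;> simp
  · intro h ρ
    have := hsAdjoint_spec Φ ρ 1
    rw [h, Matrix.mul_one, Matrix.mul_one, Matrix.trace_conjTranspose,
      Matrix.trace_conjTranspose] at this
    exact star_injective this

/-- The index of a block matrix as a pair (block, entry). -/
def blockIndex : Fin 2 × Fin 2 → Fin 2 ⊕ Fin 2
  | (0, j) => Sum.inl j
  | (1, j) => Sum.inr j

/-- The inverse of `blockIndex`. -/
def blockIndexInv : Fin 2 ⊕ Fin 2 → Fin 2 × Fin 2 := Sum.elim (fun j => (0, j)) (fun j => (1, j))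

/-- The indices of a block matrix are the pairs (block, entry). -/
def blockEquiv : Fin 2 × Fin 2 ≃ Fin 2 ⊕ Fin 2 where
  toFun := blockIndex
  invFun := blockIndexInv
  left_inv := by decide
  right_inv := by decide

/-- Up to complex conjugation and exchange of the two tensor factors, this is the Choi matrix of `Φ`
itself. -/
theorem choiMatrix_hsAdjoint_apply (Φ : M2 →ₗ[ℂ] M2) (p q j k : Fin 2) :
    choiMatrix (hsAdjoint Φ) (blockEquiv (p, j)) (blockEquiv (q, k)) =
      star (Φ (Matrix.single j k 1) p q) := by
  fin_cases p <;> fin_cases q <;>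
    simp [choiMatrix, blockEquiv, blockIndex, hsAdjoint, Matrix.trace_mul_single]

theorem posSemidef_choiMatrix_of_isCompletelyPositive {Φ : M2 →ₗ[ℂ] M2}
    (h : IsCompletelyPositive Φ) : (choiMatrix (hsAdjoint Φ)).PosSemidef := by
  obtain ⟨Ψ, rfl⟩ := h
  let E : CStarMatrix (Fin 2) (Fin 2) M2 := CStarMatrix.ofMatrix fun j k => Matrix.single j k 1
  -- Only the first row is nonzero, so `(e* e)_jk = E_j1 E_1k = E_jk`.
  let e : CStarMatrix (Fin 2) (Fin 2) M2 :=
    CStarMatrix.ofMatrix fun j k => if j = 0 then Matrix.single 0 k 1 else 0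
  have hE : E = star e * e := by
    ext j k
    rw [CStarMatrix.mul_apply, Fin.sum_univ_two]
    change Matrix.single j k 1 _ _ = ((if (0 : Fin 2) = 0 then Matrix.single 0 j 1 else 0 : M2)ᴴ *
      (if (0 : Fin 2) = 0 then Matrix.single 0 k 1 else 0 : M2) +
      (if (1 : Fin 2) = 0 then Matrix.single 0 j 1 else 0 : M2)ᴴ *
      (if (1 : Fin 2) = 0 then Matrix.single 0 k 1 else 0 : M2)) _ _
    simp
  have hpos : 0 ≤ E.map Ψ.toLinearMap :=
    Ψ.map_cstarMatrix_nonneg' 2 E (hE ▸ star_mul_self_nonneg e)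
  obtain ⟨b, hb⟩ := nonneg_iff_exists_eq_star_mul_self.1 hpos
  let W : Matrix (Fin 2 × Fin 2) (Fin 2 × Fin 2) ℂ := fun lr qk => star (b lr.1 qk.2 lr.2 qk.1)
  rw [← Matrix.posSemidef_submatrix_equiv blockEquiv]
  have : (choiMatrix (hsAdjoint Ψ.toLinearMap)).submatrix blockEquiv blockEquiv = Wᴴ * W := by
    ext ⟨p, j⟩ ⟨q, k⟩
    rw [Matrix.submatrix_apply, choiMatrix_hsAdjoint_apply]
    have h1 : Ψ.toLinearMap (Matrix.single j k 1) = (star b * b) j k := by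
      rw [← hb]; rfl
    rw [h1]
    rw [Matrix.mul_apply, Fintype.sum_prod_type]
    simp only [Matrix.conjTranspose_apply]
    simp [CStarMatrix.mul_apply, CStarMatrix.star_apply, Matrix.mul_apply,
      W, Matrix.star_eq_conjTranspose]
  rw [this]
  exact Matrix.posSemidef_conjTranspose_mul_self W

theorem isCompletelyPositive_of_posSemidef_choiMatrix {Φ : M2 →ₗ[ℂ] M2}
    (h : (choiMatrix (hsAdjoint Φ)).PosSemidef) : IsCompletelyPositive Φ := by
  rw [← Matrix.posSemidef_submatrix_equiv blockEquiv] at h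
  obtain ⟨W, hW⟩ := CStarAlgebra.nonneg_iff_eq_star_mul_self.1 (Matrix.nonneg_iff_posSemidef.2 h)
  -- Each row of `W`, reshaped to a 2 × 2 matrix, is a Kraus operator of `Φ`.
  let K : Fin 2 × Fin 2 → M2 := fun m => Matrix.of fun p j => W m (p, j)
  have hΦ : ∀ X, Φ X = ∑ m, K m * X * (K m)ᴴ := by
    intro X
    have hlin : Φ = ∑ m, (LinearMap.mulRight ℂ (K m)ᴴ ∘ₗ LinearMap.mulLeft ℂ (K m)) := by
      refine Matrix.ext_linearMap ℂ fun j k => LinearMap.ext_ring ?_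
      ext p q
      apply star_injective
      have h1 := choiMatrix_hsAdjoint_apply Φ p q j k
      have h2 := congrFun (congrFun hW (p, j)) (q, k)
      rw [Matrix.submatrix_apply, h1] at h2
      simp only [LinearMap.comp_apply, Matrix.singleLinearMap_apply]
      rw [h2]
      simp [Matrix.mul_apply, Matrix.sum_apply, K, Matrix.single_apply, Fin.sum_univ_two,
        Matrix.star_eq_conjTranspose]
      fin_cases j <;> fin_cases k <;> simp
    rw [hlin]
    simp [Matrix.mul_assoc]
  refine ⟨⟨Φ, fun k M hM => ?_⟩, rfl⟩
  obtain ⟨b, rfl⟩ := nonneg_iff_exists_eq_star_mul_self.1 hM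
  let Y : Fin 2 × Fin 2 → CStarMatrix (Fin k) (Fin k) M2 := fun m =>
    CStarMatrix.ofMatrix fun l j => b l j * (K m)ᴴ
  have : (star b * b).map Φ = ∑ m, star (Y m) * Y m := by
    ext1 i j
    have hsum : (∑ m, star (Y m) * Y m) i j = ∑ m, (star (Y m) * Y m) i j :=
      Matrix.sum_apply i j Finset.univ _
    rw [CStarMatrix.map_apply, hΦ, CStarMatrix.mul_apply, hsum]
    refine Finset.sum_congr rfl fun m _ => ?_
    rw [CStarMatrix.mul_apply, Finset.mul_sum, Finset.sum_mul]
    refine Finset.sum_congr rfl fun l _ => ?_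
    change K m * ((b l i)ᴴ * b l j) * (K m)ᴴ = (b l i * (K m)ᴴ)ᴴ * (b l j * (K m)ᴴ)
    simp [Matrix.mul_assoc]
  rw [this]
  exact Finset.sum_nonneg fun m _ => star_mul_self_nonneg _

theorem mem_stochasticMaps_iff (Φ : M2 →L[ℂ] M2) :
    Φ ∈ stochasticMaps ↔ choiMatrix (hsAdjoint (Φ : M2 →ₗ[ℂ] M2)) ∈ unitalChoiMatrices :=
  and_congr ⟨posSemidef_choiMatrix_of_isCompletelyPositive,
    isCompletelyPositive_of_posSemidef_choiMatrix⟩ (isTracePreserving_iff _)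

/-- The real-linear map taking `Φ` to the Choi matrix of its adjoint. -/
noncomputable def choiAdjoint :
    (M2 →L[ℂ] M2) →ₗ[ℝ] Matrix (Fin 2 ⊕ Fin 2) (Fin 2 ⊕ Fin 2) ℂ where
  -- Conjugate-linear over ℂ, hence only real-linear; convexity and closure need no more.
  toFun Φ := choiMatrix (hsAdjoint (Φ : M2 →ₗ[ℂ] M2))
  map_add' Φ Ψ := by
    refine (blockEquiv.forall_congr_right.1 fun x => ?_ : ∀ i, _) |> funext
    refine (blockEquiv.forall_congr_right.1 fun y => ?_ : ∀ i, _) |> funext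
    obtain ⟨p, j⟩ := x
    obtain ⟨q, k⟩ := y
    simp only [Matrix.add_apply, choiMatrix_hsAdjoint_apply]
    simp
  map_smul' r Φ := by
    refine (blockEquiv.forall_congr_right.1 fun x => ?_ : ∀ i, _) |> funext
    refine (blockEquiv.forall_congr_right.1 fun y => ?_ : ∀ i, _) |> funext
    obtain ⟨p, j⟩ := x
    obtain ⟨q, k⟩ := y
    simp only [Matrix.smul_apply, choiMatrix_hsAdjoint_apply]
    simp

theorem choiAdjoint_injective : Function.Injective choiAdjoint := by
  intro Φ Ψ h
  apply ContinuousLinearMap.coe_injective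
  refine Matrix.ext_linearMap ℂ fun j k => LinearMap.ext_ring ?_
  ext p q
  apply star_injective
  have := congrFun (congrFun h (blockEquiv (p, j))) (blockEquiv (q, k))
  exact ((choiMatrix_hsAdjoint_apply _ p q j k).symm.trans this).trans
    (choiMatrix_hsAdjoint_apply _ p q j k)

theorem choiAdjoint_surjective : Function.Surjective choiAdjoint := by
  intro B
  let L : M2 →ₗ[ℂ] M2 := ∑ j, ∑ k, (Matrix.entryLinearMap ℂ ℂ j k).smulRight
    (Matrix.of fun p q => star (B (blockEquiv (p, j)) (blockEquiv (q, k))))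
  refine ⟨LinearMap.toContinuousLinearMap L, ?_⟩
  refine (blockEquiv.forall_congr_right.1 fun x => ?_ : ∀ i, _) |> funext
  refine (blockEquiv.forall_congr_right.1 fun y => ?_ : ∀ i, _) |> funext
  refine (choiMatrix_hsAdjoint_apply _ _ _ _ _).trans ?_
  obtain ⟨p, j⟩ := x
  obtain ⟨q, k⟩ := y
  fin_cases j <;> fin_cases k <;> simp [L, Fin.sum_univ_two]

/-- `choiAdjoint` as a continuous real-linear equivalence. -/
noncomputable def choiAdjointEquiv :
    (M2 →L[ℂ] M2) ≃L[ℝ] Matrix (Fin 2 ⊕ Fin 2) (Fin 2 ⊕ Fin 2) ℂ :=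
  have : FiniteDimensional ℝ (M2 →L[ℂ] M2) :=
    (LinearEquiv.ofBijective choiAdjoint
      ⟨choiAdjoint_injective, choiAdjoint_surjective⟩).symm.finiteDimensional
  (LinearEquiv.ofBijective choiAdjoint
    ⟨choiAdjoint_injective, choiAdjoint_surjective⟩).toContinuousLinearEquiv

theorem image_choiAdjointEquiv_stochasticMaps :
    choiAdjointEquiv '' stochasticMaps = unitalChoiMatrices := by
  ext B
  constructor
  · rintro ⟨Φ, hΦ, rfl⟩
    exact (mem_stochasticMaps_iff Φ).1 hΦ
  · intro hB
    obtain ⟨Φ, rfl⟩ := choiAdjointEquiv.surjective B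
    exact ⟨Φ, (mem_stochasticMaps_iff Φ).2 hB, rfl⟩

theorem image_choiAdjointEquiv_generalizedExtremePoints :
    choiAdjointEquiv '' generalizedExtremePoints = unitaryBlocks := by
  rw [generalizedExtremePoints, ContinuousLinearEquiv.image_closure, image_extremePoints,
    image_choiAdjointEquiv_stochasticMaps, closure_extremePoints_unitalChoiMatrices]

end

theorem mainTheorem4 (Φ : M2 →L[ℂ] M2) :
    Φ ∈ generalizedExtremePoints ↔
      ∃ A U : M2, 0 ≤ A ∧ A ≤ 1 ∧ U ∈ Matrix.unitaryGroup (Fin 2) ℂ ∧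
        choiMatrix (hsAdjoint (Φ : M2 →ₗ[ℂ] M2)) =
          Matrix.fromBlocks A (CFC.sqrt A * U * CFC.sqrt (1 - A))
            (CFC.sqrt (1 - A) * Uᴴ * CFC.sqrt A) (1 - A) := by
  rw [← choiAdjointEquiv.injective.mem_set_image,
    image_choiAdjointEquiv_generalizedExtremePoints]
  rfl
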